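/- Let $M,K$ be natural numbers, let $\mathbf h,\mathbf g_1,\dots,\mathbf g_K\in\mathbb C^{M}$, and put $\mathbf H=\mathbf h\mathbf h^H$, $\mathbf G_k=\mathbf g_k\mathbf g_k^H$. Let $\sigma_0,\sigma_1,\dots,\sigma_K>0$, let $\mu_1,\dots,\mu_K,\zeta,\bar P,\bar r_0\in\mathbb R$, let $\gamma_0>0$, and assume that $\gamma_e:=\frac{1+\gamma_0}{2^{\bar r_0}}-1>0$. (In the beamforming model, $M$ is the number of transmit antennas, $K$ the number of energy receivers, $\mu_k\ge 0$ the energy weights, $0<\zeta\le 1$ the harvesting efficiency, $\bar P$ the power budget and $\bar r_0$ the target secrecy rate.) Consider the weighted sum-energy beamforming problem (P2.1): over all $0\le d\le M$, $\mathbf v_0\in\mathbb C^M$ and $\mathbf w_1,\dots,\mathbf w_d\in\mathbb C^M$, maximize $$\sum_{k=1}^K\mu_k\zeta\Big(|\mathbf v_0^H\mathbf g_k|^2+\sum_{i=1}^d|\mathbf w_i^H\mathbf g_k|^2\Big)$$ subject to $$\frac{|\mathbf v_0^H\mathbf h|^2}{\sum_{i=1}^d|\mathbf w_i^H\mathbf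 h|^2+\sigma_0^2}\ge\gamma_0,\qquad \frac{|\mathbf v_0^H\mathbf g_k|^2}{\sum_{i=1}^d|\mathbf w_i^H\mathbf g_k|^2+\sigma_k^2}\le\gamma_e\ (1\le k\le K),\qquad \|\mathbf v_0\|^2+\sum_{i=1}^d\|\mathbf w_i\|^2\le\bar P,$$ and its semidefinite relaxation (P2.1-SDR): over Hermitian $\mathbf S,\mathbf Q\in\mathbb C^{M\times M}$, maximize $$\sum_{k=1}^K\mu_k\zeta\big(\mathrm{Tr}(\mathbf G_k\mathbf S)+\mathrm{Tr}(\mathbf G_k\mathbf Q)\big)$$ subject to $$\mathrm{Tr}(\mathbf H\mathbf S)\ge\gamma_0\big(\mathrm{Tr}(\mathbf H\mathbf Q)+\sigma_0^2\big),\quad \frac{\mathrm{Tr}(\mathbf G_k\mathbf S)}{\gamma_e}\le\mathrm{Tr}(\mathbf G_k\mathbf Q)+\sigma_k^2\ (1\le k\le K),\quad \mathrm{Tr}(\mathbf S)+\mathrm{Tr}(\mathbf Q)\le\bar P,\quad \mathbf S\succeq 0,\ \mathbf Q\succeq 0.$$ Suppose that (P2.1-SDR) is feasible. Then: 1. (P2.1-SDR)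 has an optimal solution $(\mathbf S^*,\mathbf Q^*)$ with $\mathrm{rank}(\mathbf S^*)=1$. 2. The rank relaxation loses no optimality for (P2.1): for every optimal solution $(\mathbf S^*,\mathbf Q^*)$ of (P2.1-SDR) with $\mathrm{rank}(\mathbf S^*)=1$ there are $\mathbf v_0\in\mathbb C^M$ and $\mathbf w_1,\dots,\mathbf w_d\in\mathbb C^M$ with $d=\mathrm{rank}(\mathbf Q^*)$ such that $\mathbf S^*=\mathbf v_0\mathbf v_0^H$, $\mathbf Q^*=\sum_{i=1}^d\mathbf w_i\mathbf w_i^H$, the beams $(\mathbf v_0,\mathbf w_1,\dots,\mathbf w_d)$ are optimal for (P2.1), and the optimal value of (P2.1) equals that of (P2.1-SDR). -/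

import Mathlib

namespace Swipt

open Matrix
open scoped ComplexOrder

/-- Data of the secrecy beamforming problem with `M` transmit antennas, one information receiver
and `K` energy receivers. Channels are (conjugated) column vectors in `ℂ^M`. -/
structure System (M K : ℕ) where
  /-- channel of the information receiver -/
  h : Fin M → ℂ
  /-- channels of the energy receivers -/
  g : Fin K → Fin M → ℂ
  /-- noise standard deviation at the information receiver -/
  σ₀ : ℝ
  /-- noise standard deviations at the energy receivers -/
  σ : Fin K → ℝ
  /-- energy weights -/
  μ : Fin K → ℝ
  /-- energy harvesting efficiency -/
  ζ : ℝ
  /-- sum-power budget -/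
  P : ℝ
  /-- target secrecy rate -/
  r₀ : ℝ
  /-- SINR target at the information receiver -/
  γ₀ : ℝ

/-- The matrix `v v^H`. -/
def outer {M : ℕ} (v : Fin M → ℂ) : Matrix (Fin M) (Fin M) ℂ :=
  vecMulVec v (star v)

/-- The squared modulus `|v^H u|^2`. -/
noncomputable def gain {M : ℕ} (v u : Fin M → ℂ) : ℝ :=
  ‖star v ⬝ᵥ u‖ ^ 2

/-- The squared Euclidean norm `‖v‖^2`. -/
noncomputable def power {M : ℕ} (v : Fin M → ℂ) : ℝ :=
  ‖WithLp.toLp 2 v‖ ^ 2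

/-- The trace as a real number. It is applied only to positive semidefinite matrices and to
products of two of them, whose traces are real. -/
noncomputable def tr {M : ℕ} (A : Matrix (Fin M) (Fin M) ℂ) : ℝ :=
  A.trace.re

namespace System

variable {M K : ℕ}

/-- `H = h h^H`. -/
def H (p : System M K) : Matrix (Fin M) (Fin M) ℂ := outer p.h

/-- `G_k = g_k g_k^H`. -/
def G (p : System M K) (k : Fin K) : Matrix (Fin M) (Fin M) ℂ := outer (p.g k)

/-- The SINR cap at the energy receivers, `γ_e = (1 + γ₀) / 2 ^ r₀ - 1`. -/
noncomputable def γe (p : System M K) : ℝ := (1 + p.γ₀) / (2 : ℝ) ^ p.r₀ - 1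

/-! ### The beamforming problem

A design consists of a number `d ≤ M` of energy beams, an information beam `v` and
energy beams `w 0, …, w (d - 1)`. -/

/-- SINR at a receiver with channel `u` and noise standard deviation `s`. -/
noncomputable def sinr {d : ℕ} (u : Fin M → ℂ) (s : ℝ)
    (v : Fin M → ℂ) (w : Fin d → Fin M → ℂ) : ℝ :=
  gain v u / ((∑ i, gain (w i) u) + s ^ 2)

/-- Weighted sum of the harvested energies. -/
noncomputable def beamEnergy (p : System M K) {d : ℕ}
    (v : Fin M → ℂ) (w : Fin d → Fin M → ℂ) : ℝ :=
  ∑ k, p.μ k * p.ζ * (gain v (p.g k) + ∑ i, gain (w i) (p.g k))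

/-- Feasible designs with `d` energy beams. -/
structure BeamFeasible (p : System M K) {d : ℕ}
    (v : Fin M → ℂ) (w : Fin d → Fin M → ℂ) : Prop where
  card_le : d ≤ M
  sinr_ir : p.γ₀ ≤ sinr p.h p.σ₀ v w
  sinr_er : ∀ k, sinr (p.g k) (p.σ k) v w ≤ p.γe
  power_le : power v + ∑ i, power (w i) ≤ p.P

/-- Optimal designs: no feasible design, with any admissible number of energy beams,
transfers more weighted energy. -/
def BeamOptimal (p : System M K) {d : ℕ}
    (v : Fin M → ℂ) (w : Fin d → Fin M → ℂ) : Prop :=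
  p.BeamFeasible v w ∧
    ∀ (d' : ℕ) (v' : Fin M → ℂ) (w' : Fin d' → Fin M → ℂ),
      p.BeamFeasible v' w' → p.beamEnergy v' w' ≤ p.beamEnergy v w

/-! ### The semidefinite relaxation -/

/-- Objective of the relaxation. -/
noncomputable def sdrEnergy (p : System M K) (S Q : Matrix (Fin M) (Fin M) ℂ) : ℝ :=
  ∑ k, p.μ k * p.ζ * (tr (p.G k * S) + tr (p.G k * Q))

/-- Constraints of the relaxation. -/
structure SdrFeasible (p : System M K) (S Q : Matrix (Fin M) (Fin M) ℂ) : Prop where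
  sinr_ir : p.γ₀ * (tr (p.H * Q) + p.σ₀ ^ 2) ≤ tr (p.H * S)
  sinr_er : ∀ k, tr (p.G k * S) / p.γe ≤ tr (p.G k * Q) + p.σ k ^ 2
  power_le : tr S + tr Q ≤ p.P
  posS : S.PosSemidef
  posQ : Q.PosSemidef

/-- Optimal solutions of the relaxation. -/
def SdrOptimal (p : System M K) (S Q : Matrix (Fin M) (Fin M) ℂ) : Prop :=
  p.SdrFeasible S Q ∧
    ∀ S' Q' : Matrix (Fin M) (Fin M) ℂ, p.SdrFeasible S' Q' → p.sdrEnergy S' Q' ≤ p.sdrEnergy S Q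

end System

end Swipt

namespace Swipt

open Matrix
open scoped ComplexOrder

variable {M K : ℕ}

/-! The power budget bounds both traces, hence all entries, so the relaxation has a compact feasible
set and attains its maximum. At an optimum `(S, Q)`, put c = h^H S h, which is positive because
γ₀σ₀² > 0, and v = S h / √c. Then R = S - v v^H is positive semidefinite and R h = 0
(`exists_outer_le`). Moving R from S to Q keeps S + Q, hence energy and power. It changes nothing at
the information receiver, and only turns signal into noise at the energy receivers.

Conversely, rank-one S and a decomposition of Q into rank-many terms w w^H are exactly a beam design
with the same constraints and objective (`exists_eq_sum_outer`, `sdrFeasible_outer_iff`). -/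

lemma tr_add (A B : Matrix (Fin M) (Fin M) ℂ) : tr (A + B) = tr A + tr B := by
  simp [tr]

lemma tr_sum {ι : Type*} (s : Finset ι) (A : ι → Matrix (Fin M) (Fin M) ℂ) :
    tr (∑ i ∈ s, A i) = ∑ i ∈ s, tr (A i) := by
  simp [tr, trace_sum]

lemma continuous_tr : Continuous (tr : Matrix (Fin M) (Fin M) ℂ → ℝ) :=
  Complex.continuous_re.comp continuous_id.matrix_trace

lemma outer_posSemidef (v : Fin M → ℂ) : (outer v).PosSemidef :=
  posSemidef_vecMulVec_self_star v

lemma trace_outer_mul (u : Fin M → ℂ) (A : Matrix (Fin M) (Fin M) ℂ) :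
    (outer u * A).trace = star u ⬝ᵥ (A *ᵥ u) := by
  rw [outer, vecMulVec_mul, trace_vecMulVec, dotProduct_comm, ← dotProduct_mulVec]

lemma tr_outer_mul_nonneg (u : Fin M → ℂ) {A : Matrix (Fin M) (Fin M) ℂ} (hA : A.PosSemidef) :
    0 ≤ tr (outer u * A) := by
  rw [tr, trace_outer_mul]
  exact (Complex.nonneg_iff.1 (hA.dotProduct_mulVec_nonneg u)).1

lemma gain_nonneg (v u : Fin M → ℂ) : 0 ≤ gain v u := sq_nonneg _

lemma tr_outer_mul_outer (u v : Fin M → ℂ) : tr (outer u * outer v) = gain v u := by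
  have h : star u ⬝ᵥ v = star (star v ⬝ᵥ u) := by
    rw [star_dotProduct]
  rw [tr, trace_outer_mul, outer, vecMulVec_mulVec, gain, dotProduct_smul, h]
  simp [← Complex.normSq_eq_norm_sq, Complex.normSq_apply]

lemma tr_outer (v : Fin M → ℂ) : tr (outer v) = power v := by
  rw [tr, outer, trace_vecMulVec, power, EuclideanSpace.norm_sq_eq, dotProduct]
  simp [← Complex.normSq_eq_norm_sq, Complex.normSq_apply]

/-- A positive semidefinite matrix is a sum of as many matrices `w w^H` as its rank. -/
lemma exists_eq_sum_outer {A : Matrix (Fin M) (Fin M) ℂ} (hA : A.PosSemidef) :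
    ∃ w : Fin A.rank → Fin M → ℂ, A = ∑ i, outer (w i) := by
  set e := hA.1.eigenvalues
  let U : Matrix (Fin M) (Fin M) ℂ := hA.1.eigenvectorUnitary
  -- Eigenvectors scaled by √eigenvalue; those with eigenvalue zero vanish, leaving rank-many.
  let f : Fin M → Fin M → ℂ := fun j i => (Real.sqrt (e j) : ℂ) * U i j
  have hsum : A = ∑ j, outer (f j) := by
    have h := hA.1.spectral_theorem
    rw [Unitary.conjStarAlgAut_apply] at h
    ext a b
    conv_lhs => rw [h]
    rw [Matrix.sum_apply, Matrix.mul_apply]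
    refine Finset.sum_congr rfl fun j _ => ?_
    have hs : ((Real.sqrt (e j) : ℝ) : ℂ) * (Real.sqrt (e j) : ℂ) = (e j : ℂ) := by
      rw [← Complex.ofReal_mul, Real.mul_self_sqrt (hA.eigenvalues_nonneg j)]
    simp only [mul_diagonal, Function.comp_apply, star_apply, outer, vecMulVec_apply, Pi.star_apply,
      f, star_mul', RCLike.star_def, Complex.conj_ofReal, U]
    change _ * (e j : ℂ) * _ = _
    rw [← hs]
    ring
  have hcard : Fintype.card {j // e j ≠ 0} = A.rank := hA.1.rank_eq_card_non_zero_eigs.symm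
  let φ : Fin A.rank ≃ {j // e j ≠ 0} := (Fintype.equivFinOfCardEq hcard).symm
  refine ⟨fun i => f (φ i), ?_⟩
  rw [φ.sum_comp (fun j => outer (f j))]
  conv_lhs => rw [hsum]
  rw [← Finset.sum_subtype (p := fun j => e j ≠ 0) {j | e j ≠ 0} (by simp) fun j => outer (f j)]
  have hf : ∀ j ∈ Finset.univ, outer (f j) ≠ 0 → e j ≠ 0 := fun j _ hj hej => hj <| by
    ext a b
    simp [outer, vecMulVec_apply, f, hej]
  exact (Finset.sum_filter_of_ne hf).symm

/-- Termwise, |w_i| |w_j| ≤ ‖w‖², and these squares add up to the trace. -/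
lemma norm_apply_le_tr {A : Matrix (Fin M) (Fin M) ℂ} (hA : A.PosSemidef) (i j : Fin M) :
    ‖A i j‖ ≤ tr A := by
  obtain ⟨w, hw⟩ := exists_eq_sum_outer hA
  -- Frees the index type `Fin A.rank` from `A`, so that `A` can be substituted.
  generalize A.rank = d at w hw
  subst hw
  rw [tr_sum, Matrix.sum_apply]
  refine (norm_sum_le _ _).trans (Finset.sum_le_sum fun k _ => ?_)
  have hc : ∀ l, ‖w k l‖ ≤ ‖WithLp.toLp 2 (w k)‖ := fun l =>
    PiLp.norm_apply_le (WithLp.toLp 2 (w k)) l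
  rw [tr_outer, power, outer, vecMulVec_apply, norm_mul, Pi.star_apply, norm_star, sq]
  gcongr <;> apply hc

lemma isClosed_setOf_posSemidef :
    IsClosed {A : Matrix (Fin M) (Fin M) ℂ | A.PosSemidef} := by
  simp only [posSemidef_iff_dotProduct_mulVec, Set.ofPred_and, Set.ofPred_forall]
  refine (isClosed_eq continuous_id.matrix_conjTranspose continuous_id).inter
    (isClosed_iInter fun x => ?_)
  exact isClosed_le continuous_const (by fun_prop)

/-! ### Existence of an optimum by compactness -/

namespace System

variable (p : System M K)

lemma isClosed_setOf_sdrFeasible :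
    IsClosed {X : Matrix (Fin M) (Fin M) ℂ × Matrix (Fin M) (Fin M) ℂ |
      p.SdrFeasible X.1 X.2} := by
  have h : {X : Matrix (Fin M) (Fin M) ℂ × Matrix (Fin M) (Fin M) ℂ | p.SdrFeasible X.1 X.2} =
      {X | p.γ₀ * (tr (p.H * X.2) + p.σ₀ ^ 2) ≤ tr (p.H * X.1)} ∩
      ((⋂ k, {X | tr (p.G k * X.1) / p.γe ≤ tr (p.G k * X.2) + p.σ k ^ 2}) ∩
      ({X | tr X.1 + tr X.2 ≤ p.P} ∩
      ({X | X.1.PosSemidef} ∩ {X | X.2.PosSemidef}))) := by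
    ext X
    simp only [Set.mem_inter_iff, Set.mem_iInter, Set.mem_ofPred_eq]
    exact ⟨fun ⟨a, b, c, d, e⟩ => ⟨a, b, c, d, e⟩, fun ⟨a, b, c, d, e⟩ => ⟨a, b, c, d, e⟩⟩
  have htr := continuous_tr (M := M)
  rw [h]
  refine (isClosed_le ?_ ?_).inter ((isClosed_iInter fun k => isClosed_le ?_ ?_).inter
    ((isClosed_le ?_ ?_).inter ((isClosed_setOf_posSemidef.preimage continuous_fst).inter
      (isClosed_setOf_posSemidef.preimage continuous_snd)))) <;> fun_prop

lemma SdrFeasible.norm_apply_le {p : System M K} {S Q : Matrix (Fin M) (Fin M) ℂ}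
    (h : p.SdrFeasible S Q) (i j : Fin M) : ‖S i j‖ ≤ p.P ∧ ‖Q i j‖ ≤ p.P := by
  have hS := norm_apply_le_tr h.posS i j
  have hQ := norm_apply_le_tr h.posQ i j
  have hP := h.power_le
  constructor <;> linarith [norm_nonneg (S i j), norm_nonneg (Q i j)]

lemma isCompact_setOf_sdrFeasible :
    IsCompact {X : Matrix (Fin M) (Fin M) ℂ × Matrix (Fin M) (Fin M) ℂ |
      p.SdrFeasible X.1 X.2} := by
  have hB : IsCompact {A : Matrix (Fin M) (Fin M) ℂ | ∀ i j, A i j ∈ Metric.closedBall 0 p.P} := by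
    have := isCompact_univ_pi fun _ : Fin M =>
      isCompact_univ_pi fun _ : Fin M => isCompact_closedBall (0 : ℂ) p.P
    change IsCompact {A : Fin M → Fin M → ℂ | ∀ i j, A i j ∈ Metric.closedBall 0 p.P}
    simpa only [Set.pi, Set.mem_univ, forall_true_left, Set.mem_ofPred_eq] using this
  refine (hB.prod hB).of_isClosed_subset p.isClosed_setOf_sdrFeasible fun X hX => ?_
  simp only [Set.mem_prod, Set.mem_ofPred_eq, mem_closedBall_zero_iff]
  exact ⟨fun i j => (hX.norm_apply_le i j).1, fun i j => (hX.norm_apply_le i j).2⟩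

lemma exists_sdrOptimal (hfeas : ∃ S Q : Matrix (Fin M) (Fin M) ℂ, p.SdrFeasible S Q) :
    ∃ S Q : Matrix (Fin M) (Fin M) ℂ, p.SdrOptimal S Q := by
  obtain ⟨S₀, Q₀, h₀⟩ := hfeas
  have htr := continuous_tr (M := M)
  have hc : Continuous fun X : Matrix (Fin M) (Fin M) ℂ × Matrix (Fin M) (Fin M) ℂ =>
      p.sdrEnergy X.1 X.2 := by
    unfold sdrEnergy
    fun_prop
  obtain ⟨X, hX, hmax⟩ := p.isCompact_setOf_sdrFeasible.exists_isMaxOn ⟨(S₀, Q₀), h₀⟩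
    hc.continuousOn
  exact ⟨X.1, X.2, hX, fun S' Q' h' => hmax (a := (S', Q')) h'⟩

end System

/-- Splitting off a rank-one part of a positive semidefinite matrix that has the same gain
towards a given vector. -/
lemma exists_outer_le {S : Matrix (Fin M) (Fin M) ℂ} (hS : S.PosSemidef) {u : Fin M → ℂ}
    (hu : 0 < tr (outer u * S)) :
    ∃ v : Fin M → ℂ, (S - outer v).PosSemidef ∧ gain v u = tr (outer u * S) := by
  set c := tr (outer u * S) with hc
  have hc0 : (c : ℂ) ≠ 0 := by exact_mod_cast hu.ne'
  have hcC : star u ⬝ᵥ (S *ᵥ u) = (c : ℂ) := by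
    rw [hc, tr, trace_outer_mul]
    exact Complex.ext rfl (Complex.nonneg_iff.1 (hS.dotProduct_mulVec_nonneg u)).2.symm
  have hHSH : outer u * S * outer u = (c : ℂ) • outer u := by
    rw [outer, vecMulVec_mul, vecMulVec_mul_vecMulVec, ← dotProduct_mulVec, hcC]
    ext i j
    simp [vecMulVec_apply]
    ring
  have hsq : ((Real.sqrt c : ℝ) : ℂ)⁻¹ * ((Real.sqrt c : ℝ) : ℂ)⁻¹ = (c : ℂ)⁻¹ := by
    rw [← mul_inv, ← Complex.ofReal_mul, Real.mul_self_sqrt hu.le]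
  have hv : outer (((Real.sqrt c : ℝ) : ℂ)⁻¹ • (S *ᵥ u)) = (c : ℂ)⁻¹ • (S * outer u * S) := by
    rw [outer, outer, mul_vecMulVec, vecMulVec_mul, ← hsq]
    ext i j
    have : star u ᵥ* S = star (S *ᵥ u) := by
      rw [star_mulVec, hS.1.eq]
    simp [vecMulVec_apply, this]
    ring
  refine ⟨((Real.sqrt c : ℝ) : ℂ)⁻¹ • (S *ᵥ u), ?_, ?_⟩
  -- S - v v^H = B^H S B with B = 1 - c⁻¹ u u^H S, a congruence of S.
  · have h := hS.conjTranspose_mul_mul_same (1 - (c : ℂ)⁻¹ • (outer u * S))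
    convert h using 1
    rw [hv, conjTranspose_sub, conjTranspose_smul, conjTranspose_mul, hS.1.eq,
      (outer_posSemidef u).1.eq, conjTranspose_one]
    have h2 : S * outer u * S * (outer u * S) = (c : ℂ) • (S * outer u * S) := by
      calc _ = S * (outer u * S * outer u) * S := by simp only [Matrix.mul_assoc]
        _ = _ := by rw [hHSH]; simp
    simp only [sub_mul, mul_sub, one_mul, mul_one, smul_mul_assoc, mul_smul_comm, h2, smul_smul,
      star_inv₀, RCLike.star_def, Complex.conj_ofReal, ← Matrix.mul_assoc]
    simp [hc0]
  · rw [← tr_outer_mul_outer, hv, mul_smul_comm, ← Matrix.mul_assoc, ← Matrix.mul_assoc, hHSH,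
      smul_mul_assoc, smul_smul, inv_mul_cancel₀ hc0, one_smul]

lemma rank_outer {v : Fin M → ℂ} (hv : outer v ≠ 0) : (outer v).rank = 1 := by
  refine le_antisymm (rank_vecMulVec_le _ _) (Nat.one_le_iff_ne_zero.2 fun h => hv ?_)
  obtain ⟨w, hw⟩ := exists_eq_sum_outer (outer_posSemidef v)
  generalize (outer v).rank = d at w hw h
  subst h
  simpa using hw

namespace System

variable (p : System M K)

lemma exists_sdrOptimal_rank_one (hσ₀ : 0 < p.σ₀) (hγ₀ : 0 < p.γ₀) (hγe : 0 < p.γe)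
    (hfeas : ∃ S Q : Matrix (Fin M) (Fin M) ℂ, p.SdrFeasible S Q) :
    ∃ S Q : Matrix (Fin M) (Fin M) ℂ, p.SdrOptimal S Q ∧ S.rank = 1 := by
  obtain ⟨S, Q, hSQ, hmax⟩ := p.exists_sdrOptimal hfeas
  have hpos : 0 < tr (outer p.h * S) := by
    have h1 := tr_outer_mul_nonneg p.h hSQ.posQ
    have h2 : p.γ₀ * (tr (outer p.h * Q) + p.σ₀ ^ 2) ≤ tr (outer p.h * S) := hSQ.sinr_ir
    exact lt_of_lt_of_le (by positivity) h2
  obtain ⟨v, hv, hgain⟩ := exists_outer_le hSQ.posS hpos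
  rw [← tr_outer_mul_outer] at hgain
  have hsplit : ∀ A : Matrix (Fin M) (Fin M) ℂ,
      tr (A * (Q + (S - outer v))) = tr (A * Q) + (tr (A * S) - tr (A * outer v)) := fun A => by
    simp [tr, mul_add, mul_sub]
  -- The identity matrix gives the power constraint.
  have hsplit1 := hsplit 1
  simp only [one_mul] at hsplit1
  have hE : p.sdrEnergy (outer v) (Q + (S - outer v)) = p.sdrEnergy S Q := by
    refine Finset.sum_congr rfl fun k _ => ?_
    rw [hsplit]
    ring
  refine ⟨outer v, Q + (S - outer v), ⟨⟨?_, fun k => ?_, ?_, outer_posSemidef v,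
    hSQ.posQ.add hv⟩, fun S' Q' h' => hE ▸ hmax S' Q' h'⟩, rank_outer fun h => ?_⟩
  · rw [hsplit, H, hgain, sub_self, add_zero]
    exact hSQ.sinr_ir
  · have h1 := tr_outer_mul_nonneg (p.g k) hv
    have h2 : tr (p.G k * (S - outer v)) = tr (p.G k * S) - tr (p.G k * outer v) := by
      simp [tr, mul_sub]
    rw [← G, h2, sub_nonneg] at h1
    have h3 := hSQ.sinr_er k
    have h4 := div_le_div_of_nonneg_right h1 hγe.le
    rw [hsplit]
    linarith
  · rw [hsplit1]
    linarith [hSQ.power_le]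
  -- If v v^H were zero, the positive gain towards h would vanish.
  · rw [h] at hgain
    simp only [mul_zero, tr, trace_zero, Complex.zero_re] at hgain hpos
    linarith

variable {p} {d : ℕ} (v : Fin M → ℂ) (w : Fin d → Fin M → ℂ)

/-- Noise makes every SINR denominator positive, so the fractions can be cleared without loss. -/
lemma sdrFeasible_outer_iff (hσ₀ : 0 < p.σ₀) (hσ : ∀ k, 0 < p.σ k) (hγe : 0 < p.γe)
    (hd : d ≤ M) :
    p.SdrFeasible (outer v) (∑ i, outer (w i)) ↔ p.BeamFeasible v w := by
  have hden : ∀ (u : Fin M → ℂ) {s : ℝ}, 0 < s → 0 < (∑ i, gain (w i) u) + s ^ 2 := fun u s hs =>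
    add_pos_of_nonneg_of_pos (Finset.sum_nonneg fun i _ => gain_nonneg _ _) (by positivity)
  have hQ : (∑ i, outer (w i)).PosSemidef := posSemidef_sum _ fun i _ => outer_posSemidef (w i)
  constructor
  · rintro ⟨h1, h2, h3, -, -⟩
    simp only [H, G, Finset.mul_sum, tr_sum, tr_outer_mul_outer, tr_outer] at h1 h2 h3
    exact ⟨hd, (le_div_iff₀ (hden _ hσ₀)).2 h1,
      fun k => (div_le_comm₀ hγe (hden _ (hσ k))).1 (h2 k), h3⟩
  · rintro ⟨-, h1, h2, h3⟩
    refine ⟨?_, fun k => ?_, ?_, outer_posSemidef v, hQ⟩ <;>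
      simp only [H, G, Finset.mul_sum, tr_sum, tr_outer_mul_outer, tr_outer]
    · exact (le_div_iff₀ (hden _ hσ₀)).1 h1
    · exact (div_le_comm₀ hγe (hden _ (hσ k))).2 (h2 k)
    · exact h3

lemma sdrEnergy_outer : p.sdrEnergy (outer v) (∑ i, outer (w i)) = p.beamEnergy v w := by
  simp only [sdrEnergy, beamEnergy, G, Finset.mul_sum, tr_sum, tr_outer_mul_outer]

end System

end Swipt

open Swipt in
theorem mainTheorem7 {M K : ℕ} (p : Swipt.System M K)
    (hσ₀ : 0 < p.σ₀) (hσ : ∀ k, 0 < p.σ k) (hγ₀ : 0 < p.γ₀) (hγe : 0 < p.γe)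
    (hfeas : ∃ S Q : Matrix (Fin M) (Fin M) ℂ, p.SdrFeasible S Q) :
    (∃ S Q : Matrix (Fin M) (Fin M) ℂ, p.SdrOptimal S Q ∧ S.rank = 1) ∧
    (∀ S Q : Matrix (Fin M) (Fin M) ℂ, p.SdrOptimal S Q → S.rank = 1 →
      ∃ (v : Fin M → ℂ) (w : Fin Q.rank → Fin M → ℂ),
        S = Swipt.outer v ∧ Q = ∑ i, Swipt.outer (w i) ∧
        p.BeamOptimal v w ∧ p.beamEnergy v w = p.sdrEnergy S Q) := by
  refine ⟨p.exists_sdrOptimal_rank_one hσ₀ hγ₀ hγe hfeas, ?_⟩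
  rintro S Q ⟨hSQ, hmax⟩ hrank
  have hS : ∃ v, S = outer v := by
    obtain ⟨w, hw⟩ := exists_eq_sum_outer hSQ.posS
    generalize S.rank = r at w hw hrank
    subst hrank
    exact ⟨w 0, by simpa using hw⟩
  obtain ⟨v, hv⟩ := hS
  obtain ⟨w, hw⟩ := exists_eq_sum_outer hSQ.posQ
  have hd : Q.rank ≤ M := by simpa using Q.rank_le_width
  have hE : p.beamEnergy v w = p.sdrEnergy S Q := by
    rw [← System.sdrEnergy_outer, ← hw, ← hv]
  refine ⟨v, w, hv, hw, ⟨?_, fun d' v' w' h' => ?_⟩, hE⟩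
  · rw [← System.sdrFeasible_outer_iff v w hσ₀ hσ hγe hd, ← hw, ← hv]
    exact hSQ
  -- Any competing design, whatever its number of beams, is a feasible point of the relaxation.
  · rw [hE, ← System.sdrEnergy_outer]
    exact hmax _ _ ((System.sdrFeasible_outer_iff v' w' hσ₀ hσ hγe h'.card_le).2 h')
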